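/- Let $k\ge 2$, and let ${\bf x}=a(0)a(1)a(2)\cdots$ be a $k$-automatic sequence over a linearly ordered alphabet: there is a finite deterministic automaton with output that, on reading the base-$k$ expansion of $n$ (most significant digit first, no leading zeros), outputs $a(n)$. Write ${\bf x}[i..\infty]$ for the infinite word $a(i)a(i+1)a(i+2)\cdots$. For $n\ge 0$ and $i\ge 0$, the permutation of length $n$ induced by ${\bf x}$ at position $i$ is the order on $\{0,\dots,n-1\}$ in which $l$ precedes $m$ if and only if ${\bf x}[i+l..\infty]$ is lexicographically less than ${\bf x}[i+m..\infty]$. (If ${\bf x}$ is not eventually periodic, this is a linear order, i.e. a permutation of $\{0,\dots,n-1\}$; if ${\bf x}$ is eventually periodic, equal suffixes are left incomparable.) The permutation complexity $p_{\bf x}(n)$ is the number of distinct orders induced in this way as $i$ ranges over all positions. **Theorem.** The sequence $(p_{\bf x}(n))_{n\ge 0}$ is $(\mathbb N,k)$-regular. That is, there are an integer $r\ge 0$, a row vector $u\in\mathbb N^{1\times r}$, a column vector $v\in\mathbb N^{r\times 1}$ and matrices $\mu(0),\dots,\mu(k-1)\in\mathbb N^{r\times r}$ such that $$p_{\bf x}\Bigl(\sum_{1\le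 j\le s} c_j k^{s-j}\Bigr)=u\,\mu(c_1)\mu(c_2)\cdots\mu(c_s)\,v$$ for every word $c_1c_2\cdots c_s$ $(s\ge 0)$ over the digits $\{0,1,\dots,k-1\}$. In particular, the permutation complexity of the Thue–Morse word, whose $n$-th letter is the parity of the number of ones in the binary expansion of $n$ (with $0<1$), is $(\mathbb N,2)$-regular. -/

import Mathlib

/-- The integer `[w]_k` represented in base `k` by the word `w`, most significant digit first. -/
def wordVal (k : ℕ) (w : List (Fin k)) : ℕ :=
  Nat.ofDigits k (w.reverse.map Fin.val)

/-- Canonical base-`k` expansions: the empty word and the words whose first letter is not `0`. -/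
def IsCanonical {k : ℕ} (w : List (Fin k)) : Prop :=
  ∀ a ∈ w.head?, (a : ℕ) ≠ 0

/-- `x` is `k`-automatic: some finite automaton with output, reading the canonical base-`k`
expansion of `n` (most significant digit first), outputs `x n`. -/
def IsAutomatic (k : ℕ) {A : Type*} (x : ℕ → A) : Prop :=
  ∃ (Q : Type) (_ : Finite Q) (M : DFA (Fin k) Q) (out : Q → A),
    ∀ w : List (Fin k), IsCanonical w → x (wordVal k w) = out (M.eval w)

/-- A formal series `h : Σ* → R` is `R`-recognizable if it has a linear representation
`(u, μ, v)`, i.e. `h w = u * μ(w) * v`, where `μ` is the morphism from words to square matrices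
determined by its values on letters. -/
def IsRecognizable (R : Type*) [Semiring R] {S : Type*} (h : List S → R) : Prop :=
  ∃ (r : ℕ) (u : Fin r → R) (μ : S → Matrix (Fin r) (Fin r) R) (v : Fin r → R),
    ∀ w : List S, h w = u ⬝ᵥ ((w.map μ).prod.mulVec v)

/-- `f` is `(R, k)`-regular: `w ↦ f([w]_k)` is an `R`-recognizable series on all words over
the digits `0, …, k - 1` (leading zeros included). -/
def IsRegularSeq (R : Type*) [Semiring R] (k : ℕ) (f : ℕ → R) : Prop :=
  IsRecognizable R (fun w : List (Fin k) => f (wordVal k w))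

/-- The infinite word `x[i..∞]`, as an element of the lexicographically ordered sequences. -/
def suffix {A : Type*} (x : ℕ → A) (i : ℕ) : Lex (ℕ → A) :=
  toLex (fun t => x (i + t))

/-- The order on `{0, …, n - 1}` induced by the lexicographic order of the `n` suffixes of `x`
starting at the positions `i, …, i + n - 1`. -/
def inducedOrder {A : Type*} [LinearOrder A] (x : ℕ → A) (n i : ℕ) : Fin n → Fin n → Prop :=
  fun l m => suffix x (i + l) < suffix x (i + m)

/-- Permutation complexity: the number of distinct orders on `{0, …, n - 1}` induced by `x`.
See `permComplexity_eq_ncard_perm` for the form with permutations. -/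
noncomputable def permComplexity {A : Type*} [LinearOrder A] (x : ℕ → A) (n : ℕ) : ℕ :=
  (Set.range (inducedOrder x n)).ncard

/-- The Thue–Morse word: the parity of the number of ones in the binary expansion of `n`. -/
def thueMorse (n : ℕ) : ℕ := (Nat.digits 2 n).sum % 2

/-- If the suffixes of `x` are pairwise distinct (equivalently, `x` is not eventually periodic),
the induced orders are linear, and `permComplexity x n` is the number of permutations `σ` of
`{0, …, n - 1}` that are order isomorphic to `n` consecutive suffixes of `x`. -/
theorem permComplexity_eq_ncard_perm {A : Type*} [LinearOrder A] (x : ℕ → A)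
    (hx : Function.Injective (suffix x)) (n : ℕ) :
    permComplexity x n =
      {σ : Equiv.Perm (Fin n) | ∃ i, ∀ l m : Fin n,
        σ l < σ m ↔ suffix x (i + l) < suffix x (i + m)}.ncard := by
  classical
  symm
  refine Set.ncard_congr (fun σ _ => fun l m : Fin n => σ l < σ m) ?_ ?_ ?_
  · rintro σ ⟨i, hi⟩
    exact ⟨i, by funext l m; exact propext (hi l m).symm⟩
  · intro σ τ _ _ h
    have h' : ∀ l m, σ l < σ m ↔ τ l < τ m := fun l m => iff_of_eq (congrFun (congrFun h l) m)
    have hm : StrictMono (σ.symm.trans τ) := by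
      intro a b hab
      have := (h' (σ.symm a) (σ.symm b)).1 (by simpa using hab)
      simpa using this
    have he : (hm.orderIsoOfSurjective _ (σ.symm.trans τ).surjective) = OrderIso.refl (Fin n) :=
      Subsingleton.elim _ _
    ext l : 1
    have := congrArg (fun e : Fin n ≃o Fin n => e (σ l)) he
    simpa using this.symm
  · rintro _ ⟨i, rfl⟩
    let f : Fin n → Lex (ℕ → A) := fun l => suffix x (i + l)
    have hf : Function.Injective f := fun l m h => by
      have := hx h
      exact Fin.ext (by omega)
    let s : Finset (Lex (ℕ → A)) := Finset.univ.image f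
    have hs : s.card = n := by
      rw [Finset.card_image_of_injective _ hf, Finset.card_univ, Fintype.card_fin]
    let g : Fin n → Fin n := fun l => (s.orderIsoOfFin hs).symm ⟨f l, by simp [s]⟩
    have hg : ∀ l m, g l < g m ↔ f l < f m := fun l m => by
      simp only [g, OrderIso.lt_iff_lt, Subtype.mk_lt_mk]
      exact Iff.rfl
    have hgi : Function.Injective g := fun l m h => by
      apply hf
      have h1 := (hg l m).not.1 (by simp [h])
      have h2 := (hg m l).not.1 (by simp [h])
      exact le_antisymm (not_lt.1 h2) (not_lt.1 h1)
    refine ⟨Equiv.ofBijective g (Finite.injective_iff_bijective.1 hgi), ⟨i, fun l m => ?_⟩, ?_⟩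
    · exact hg l m
    · funext l m
      exact propext (hg l m)

/-- A predicate on assignments `ℕ → ℕ` of natural numbers to variables is `k`-automatic if it is
decided by a finite-state invariant that can be updated when a base-`k` digit is appended to the
value of every variable. -/
def IsAutomaticRel (k : ℕ) (P : (ℕ → ℕ) → Prop) : Prop :=
  ∃ (Q : Type) (_ : Finite Q) (φ : (ℕ → ℕ) → Q) (δ : Q → (ℕ → ℕ) → Q) (out : Q → Prop),
    (∀ v c, (∀ i, c i < k) → φ (fun i => k * v i + c i) = δ (φ v) c) ∧ ∀ v, P v ↔ out (φ v)

namespace IsAutomaticRel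

variable {k : ℕ} {P P' : (ℕ → ℕ) → Prop}

theorem congr (h : IsAutomaticRel k P) (e : ∀ v, P' v ↔ P v) : IsAutomaticRel k P' := by
  obtain ⟨Q, hQ, φ, δ, out, h1, h2⟩ := h
  exact ⟨Q, hQ, φ, δ, out, h1, fun v => (e v).trans (h2 v)⟩

theorem not (h : IsAutomaticRel k P) : IsAutomaticRel k (fun v => ¬ P v) := by
  obtain ⟨Q, hQ, φ, δ, out, h1, h2⟩ := h
  exact ⟨Q, hQ, φ, δ, fun q => ¬ out q, h1, fun v => not_congr (h2 v)⟩

theorem and (h : IsAutomaticRel k P) (h' : IsAutomaticRel k P') :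
    IsAutomaticRel k (fun v => P v ∧ P' v) := by
  obtain ⟨Q, hQ, φ, δ, out, h1, h2⟩ := h
  obtain ⟨Q', hQ', φ', δ', out', h1', h2'⟩ := h'
  exact ⟨Q × Q', inferInstance, fun v => (φ v, φ' v), fun q c => (δ q.1 c, δ' q.2 c),
    fun q => out q.1 ∧ out' q.2, fun v c hc => by simp only [h1 v c hc, h1' v c hc],
    fun v => and_congr (h2 v) (h2' v)⟩

theorem imp (h : IsAutomaticRel k P) (h' : IsAutomaticRel k P') :
    IsAutomaticRel k (fun v => P v → P' v) :=
  (h.and h'.not).not.congr fun v => by tauto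

theorem iff (h : IsAutomaticRel k P) (h' : IsAutomaticRel k P') :
    IsAutomaticRel k (fun v => P v ↔ P' v) :=
  ((h.imp h').and (h'.imp h)).congr fun v => by tauto

theorem exists_update (a : ℕ) (hk : 0 < k) (h : IsAutomaticRel k P) :
    IsAutomaticRel k (fun v => ∃ j, P (Function.update v a j)) := by
  obtain ⟨Q, hQ, φ, δ, out, h1, h2⟩ := h
  have key : ∀ (v c : ℕ → ℕ) (j d : ℕ), (∀ i, c i < k) → d < k →
      φ (Function.update (fun i => k * v i + c i) a (k * j + d)) =
        δ (φ (Function.update v a j)) (Function.update c a d) := by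
    intro v c j d hc hd
    rw [← h1]
    · congr 1
      funext i
      by_cases hi : i = a
      · subst hi; simp
      · simp [hi]
    · intro i
      by_cases hi : i = a
      · subst hi; simpa using hd
      · simpa [hi] using hc i
  refine ⟨Set Q, inferInstance, fun v => {q | ∃ j, φ (Function.update v a j) = q},
    fun S c => {q | ∃ p ∈ S, ∃ d < k, δ p (Function.update c a d) = q},
    fun S => ∃ q ∈ S, out q, ?_, ?_⟩
  · intro v c hc
    ext q
    constructor
    · rintro ⟨j, rfl⟩
      refine ⟨_, ⟨j / k, rfl⟩, j % k, Nat.mod_lt _ hk, ?_⟩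
      rw [← key v c _ _ hc (Nat.mod_lt _ hk), Nat.div_add_mod]
    · rintro ⟨_, ⟨j, rfl⟩, d, hd, rfl⟩
      exact ⟨k * j + d, key v c j d hc hd⟩
  · intro v
    simp [h2]

theorem forall_update (a : ℕ) (hk : 0 < k) (h : IsAutomaticRel k P) :
    IsAutomaticRel k (fun v => ∀ j, P (Function.update v a j)) :=
  (h.not.exists_update a hk).not.congr fun v => by simp

theorem rename (σ : ℕ → ℕ) (h : IsAutomaticRel k P) :
    IsAutomaticRel k (fun v => P (fun i => v (σ i))) := by
  obtain ⟨Q, hQ, φ, δ, out, h1, h2⟩ := h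
  exact ⟨Q, hQ, fun v => φ (fun i => v (σ i)), fun q c => δ q (fun i => c (σ i)), out,
    fun v c hc => h1 _ _ fun i => hc _, fun v => h2 _⟩

theorem lt (a b : ℕ) : IsAutomaticRel k (fun v => v a < v b) := by
  refine ⟨Ordering, inferInstance, fun v => compare (v a) (v b),
    fun q c => q.then (compare (c a) (c b)), fun q => q = .lt, fun v c hc => ?_, fun v => ?_⟩
  · have ha := hc a
    have hb := hc b
    beta_reduce
    rcases lt_trichotomy (v a) (v b) with h | h | h
    · rw [compare_lt_iff_lt.2 h]
      refine compare_lt_iff_lt.2 ?_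
      nlinarith
    · rw [compare_eq_iff_eq.2 h, h]
      simp only [Ordering.then]
      rcases lt_trichotomy (c a) (c b) with h' | h' | h'
      · rw [compare_lt_iff_lt.2 h']
        exact compare_lt_iff_lt.2 (by omega)
      · rw [h']
        simp
      · rw [compare_gt_iff_gt.2 h']
        exact compare_gt_iff_gt.2 (by omega)
    · rw [compare_gt_iff_gt.2 h]
      refine compare_gt_iff_gt.2 ?_
      nlinarith
  · exact compare_lt_iff_lt.symm

/-- The finite-state invariant is the carry `v a - v b - v c`, truncated to `[-1, 2]`. -/
theorem eq_add (a b c : ℕ) : IsAutomaticRel k (fun v => v a = v b + v c) := by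
  let clamp : ℤ → Set.Icc (-1 : ℤ) 2 := Set.projIcc (-1) 2 (by norm_num)
  have hclamp : ∀ d, ((clamp d : Set.Icc (-1 : ℤ) 2) : ℤ) = max (-1) (min 2 d) :=
    fun d => Set.coe_projIcc _ _ _ _
  refine ⟨Set.Icc (-1 : ℤ) 2, inferInstance, fun v => clamp ((v a : ℤ) - v b - v c),
    fun q d => clamp (k * (q : ℤ) + ((d a : ℤ) - d b - d c)), fun q => (q : ℤ) = 0,
    fun v d hd => ?_, fun v => ?_⟩
  · have ha := hd a
    have hb := hd b
    have hc := hd c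
    apply Subtype.ext
    simp only [hclamp]
    push_cast
    zify at ha hb hc
    have h0 : (0 : ℤ) ≤ d a := by positivity
    have h1 : (0 : ℤ) ≤ d b := by positivity
    have h2 : (0 : ℤ) ≤ d c := by positivity
    have e : (k * v a + d a - (k * v b + d b) - (k * v c + d c) : ℤ) =
        k * (v a - v b - v c) + (d a - d b - d c) := by ring
    rw [e]
    generalize ((v a : ℤ) - v b - v c) = z
    rcases lt_or_ge z (-1) with hz | hz
    · have : max (-1) (min 2 z) = -1 := by omega
      rw [this]
      have : (k : ℤ) * z ≤ k * (-1) := by nlinarith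
      omega
    · rcases lt_or_ge 2 z with hz' | hz'
      · have : max (-1) (min 2 z) = 2 := by omega
        rw [this]
        have : (k : ℤ) * 2 ≤ k * z := by nlinarith
        omega
      · have : max (-1) (min 2 z) = z := by omega
        rw [this]
  · simp only [hclamp]
    omega

theorem comp_add (hk : 0 < k) {T : ℕ → ℕ → Prop}
    (h : ∀ a b, IsAutomaticRel k (fun v => T (v a) (v b))) (a b c d : ℕ) :
    IsAutomaticRel k (fun v => T (v a + v b) (v c + v d)) := by
  have h1 : IsAutomaticRel k (fun v => T (v 0 + v 1) (v 2 + v 3)) :=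
    ((((eq_add 4 0 1).and ((eq_add 5 2 3).and (h 4 5))).exists_update 5 hk).exists_update 4
      hk).congr fun v => by simp
  exact (h1.rename fun i => if i = 0 then a else if i = 1 then b else if i = 2 then c else d).congr
    fun v => by simp

end IsAutomaticRel

theorem wordVal_concat {k : ℕ} (w : List (Fin k)) (c : Fin k) :
    wordVal k (w ++ [c]) = k * wordVal k w + c := by
  simp [wordVal, Nat.ofDigits_cons, add_comm]

theorem exists_finite_state_of_isAutomatic {k : ℕ} (hk : 2 ≤ k) {A : Type*} {x : ℕ → A}
    (hx : IsAutomatic k x) :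
    ∃ (Q : Type) (_ : Finite Q) (φ : ℕ → Q) (δ : Q → ℕ → Q) (out : Q → A),
      (∀ m c, c < k → φ (k * m + c) = δ (φ m) c) ∧ ∀ n, x n = out (φ n) := by
  obtain ⟨Q, hQ, M, out, h⟩ := hx
  have : NeZero k := ⟨by omega⟩
  let canon : ℕ → List (Fin k) := fun n => ((Nat.digits k n).map (Fin.ofNat k)).reverse
  have canon_add : ∀ m c, c < k → k * m + c ≠ 0 →
      canon (k * m + c) = canon m ++ [Fin.ofNat k c] := by
    intro m c hc h0
    have : Nat.digits k (k * m + c) = c :: Nat.digits k m := by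
      rw [add_comm]
      refine Nat.digits_add k (by omega) c m hc ?_
      by_contra! h'
      simp [h'.1, h'.2] at h0
    simp [canon, this]
  have wordVal_canon : ∀ n, wordVal k (canon n) = n := by
    intro n
    have : (Nat.digits k n).map (fun c => c % k) = Nat.digits k n := by
      conv_rhs => rw [← List.map_id (Nat.digits k n)]
      exact List.map_congr_left fun c hc => Nat.mod_eq_of_lt (Nat.digits_lt_base (by omega) hc)
    have e : (canon n).reverse.map Fin.val = Nat.digits k n := by
      simp only [canon, List.reverse_reverse, List.map_map]
      exact this
    rw [wordVal, e, Nat.ofDigits_digits]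
  have isCanonical_canon : ∀ n, IsCanonical (canon n) := by
    intro n a ha
    rcases Nat.eq_zero_or_pos n with rfl | hn
    · simp [canon] at ha
    · have hne : Nat.digits k n ≠ [] := Nat.digits_ne_nil_iff_ne_zero.2 hn.ne'
      have hl := Nat.getLast_digit_ne_zero k hn.ne'
      simp only [canon, List.head?_reverse, List.getLast?_map, List.getLast?_eq_getLast_of_ne_nil hne,
        Option.map_some, Option.mem_def, Option.some.injEq] at ha
      rw [← ha]
      simpa [Nat.mod_eq_of_lt (Nat.digits_lt_base (b := k) (by omega) (List.getLast_mem hne))]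
        using hl
  refine ⟨Option Q, inferInstance, fun n => if n = 0 then none else some (M.eval (canon n)),
    fun q c => match q with
      | none => if c = 0 then none else some (M.step M.start (Fin.ofNat k c))
      | some q => some (M.step q (Fin.ofNat k c)),
    fun q => out (q.getD M.start), fun m c hc => ?_, fun n => ?_⟩
  · rcases Nat.eq_zero_or_pos m with rfl | hm
    · rcases Nat.eq_zero_or_pos c with rfl | hc0
      · simp
      · have := canon_add 0 c hc (by omega)
        have h0 : canon 0 = [] := by simp [canon]
        rw [h0] at this
        simp only [this]
        simp [hc0.ne', DFA.eval, DFA.evalFrom]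
    · have hkm : k * m + c ≠ 0 := by
        have : 0 < k * m := Nat.mul_pos (by omega) hm
        omega
      simp only [if_neg hkm, if_neg hm.ne', canon_add m c hc hkm, DFA.eval_append_singleton]
  · conv_lhs => rw [← wordVal_canon n, h _ (isCanonical_canon n)]
    by_cases hn : n = 0
    · subst hn
      simp [canon]
    · simp [hn]

section FirstOccurrence

variable {k : ℕ} {A : Type*} {x : ℕ → A}

theorem IsAutomatic.isAutomaticRel (hk : 2 ≤ k) (hx : IsAutomatic k x) (R : A → A → Prop)
    (a b : ℕ) : IsAutomaticRel k (fun v => R (x (v a)) (x (v b))) := by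
  obtain ⟨Q, hQ, φ, δ, out, h1, h2⟩ := exists_finite_state_of_isAutomatic hk hx
  exact ⟨Q × Q, inferInstance, fun v => (φ (v a), φ (v b)), fun q c => (δ q.1 (c a), δ q.2 (c b)),
    fun q => R (out q.1) (out q.2), fun v c hc => by simp only [h1 _ _ (hc _)],
    fun v => by simp only [h2]⟩

variable [LinearOrder A]

theorem IsAutomatic.suffix_lt (hk : 2 ≤ k) (hx : IsAutomatic k x) (a b : ℕ) :
    IsAutomaticRel k (fun v => suffix x (v a) < suffix x (v b)) := by
  have hk0 : 0 < k := by omega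
  have hR := fun R => IsAutomaticRel.comp_add hk0 (T := fun i j => R (x i) (x j))
    (hx.isAutomaticRel hk R)
  have h : IsAutomaticRel k (fun v => suffix x (v 0) < suffix x (v 1)) :=
    (((((IsAutomaticRel.lt 3 2).imp (hR (· = ·) 0 3 1 3)).forall_update 3 hk0).and
      (hR (· < ·) 0 2 1 2)).exists_update 2 hk0).congr fun v => by
        simp only [Function.update_apply]
        exact Iff.rfl
  exact (h.rename fun i => if i = 0 then a else b).congr fun v => by simp

theorem IsAutomatic.inducedOrder_eq (hk : 2 ≤ k) (hx : IsAutomatic k x) :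
    IsAutomaticRel k (fun v => inducedOrder x (v 0) (v 1) = inducedOrder x (v 0) (v 2)) := by
  have hk0 : 0 < k := by omega
  have hT := IsAutomaticRel.comp_add hk0 (T := fun i j => suffix x i < suffix x j)
    (hx.suffix_lt hk)
  refine ((((IsAutomaticRel.lt 3 0).imp ((IsAutomaticRel.lt 4 0).imp
    ((hT 1 3 1 4).iff (hT 2 3 2 4)))).forall_update 4 hk0).forall_update 3 hk0).congr fun v => ?_
  simp only [Function.update_apply]
  norm_num
  constructor
  · intro h l m hl hm
    exact iff_of_eq (congrFun (congrFun h ⟨l, hl⟩) ⟨m, hm⟩)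
  · intro h
    funext l m
    exact propext (h l m l.2 m.2)

/-- The positions at which an order occurs for the first time. -/
theorem IsAutomatic.first_occurrence (hk : 2 ≤ k) (hx : IsAutomatic k x) :
    IsAutomaticRel k
      (fun v => ∀ j < v 1, inducedOrder x (v 0) (v 1) ≠ inducedOrder x (v 0) j) :=
  (((IsAutomaticRel.lt 2 1).imp (hx.inducedOrder_eq hk).not).forall_update 2 (by omega)).congr
    fun _ => Iff.rfl

end FirstOccurrence

theorem Set.ncard_range_eq_ncard_first {β : Type*} (f : ℕ → β) :
    (Set.range f).ncard = {i | ∀ j < i, f i ≠ f j}.ncard := by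
  classical
  symm
  refine Set.ncard_congr (fun i _ => f i) (fun i _ => ⟨i, rfl⟩) ?_ ?_
  · intro i j hi hj h
    rcases lt_trichotomy i j with hij | hij | hij
    · exact absurd h.symm (hj i hij)
    · exact hij
    · exact absurd h (hi j hij)
  · rintro _ ⟨i, rfl⟩
    have hex : ∃ j, f j = f i := ⟨i, rfl⟩
    exact ⟨Nat.find hex, fun j hj h => Nat.find_min hex hj (h ▸ Nat.find_spec hex),
      Nat.find_spec hex⟩

theorem wordVal_cons {k : ℕ} (c : Fin k) (w : List (Fin k)) :
    wordVal k (c :: w) = k ^ w.length * c + wordVal k w := by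
  simp [wordVal, Nat.ofDigits_append, add_comm]

theorem wordVal_lt {k : ℕ} (hk : 1 < k) (w : List (Fin k)) : wordVal k w < k ^ w.length := by
  simpa [wordVal] using Nat.ofDigits_lt_base_pow_length (b := k) (l := w.reverse.map Fin.val) hk
    (by simp only [List.mem_map]; rintro _ ⟨a, _, rfl⟩; exact a.2)

theorem Set.ncard_lt_mul (a b : ℕ) (P : ℕ → Prop) :
    {i | i < a * b ∧ P i}.ncard = ∑ d ∈ Finset.range a, {i | i < b ∧ P (b * d + i)}.ncard := by
  classical
  have hc : ∀ (n : ℕ) (R : ℕ → Prop),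
      {i | i < n ∧ R i}.ncard = ∑ i ∈ Finset.range n, if R i then 1 else 0 := by
    intro n R
    have : {i | i < n ∧ R i} = ((Finset.range n).filter R : Set ℕ) := by ext; simp
    rw [this, Set.ncard_coe_finset, Finset.card_filter]
  simp only [hc]
  induction a with
  | zero => simp
  | succ a ih => rw [Finset.sum_range_succ, ← ih, Nat.succ_mul, Finset.sum_range_add, mul_comm a b]

section Counting

variable {k r : ℕ} (φ : ℕ → ℕ → Fin r) (δ : Fin r → ℕ → ℕ → Fin r) (out : Fin r → Prop)

/-- The number of ways to move from `q` to `q'` by appending the digit `c` to the first number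
and some digit to the second one. -/
def transitionMatrix (k : ℕ) {r : ℕ} (δ : Fin r → ℕ → ℕ → Fin r) (c : Fin k) :
    Matrix (Fin r) (Fin r) ℕ :=
  fun q q' => ∑ d ∈ Finset.range k, if δ q c d = q' then 1 else 0

open Classical in
/-- The indicator vector of the accepting states. -/
noncomputable def acceptVector {r : ℕ} (out : Fin r → Prop) : Fin r → ℕ :=
  fun q => if out q then 1 else 0

variable {φ δ}

theorem state_eq_of_append (hk : 0 < k)
    (h : ∀ n i c d, c < k → d < k → φ (k * n + c) (k * i + d) = δ (φ n i) c d)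
    {n i n' i' : ℕ} (e : φ n i = φ n' i') (s : ℕ) : ∀ {c d : ℕ}, c < k ^ s → d < k ^ s →
      φ (k ^ s * n + c) (k ^ s * i + d) = φ (k ^ s * n' + c) (k ^ s * i' + d) := by
  induction s with
  | zero =>
    intro c d hc hd
    simp only [pow_zero, Nat.lt_one_iff] at hc hd
    simpa [hc, hd] using e
  | succ s ih =>
    intro c d hc hd
    have hs : ∀ m c, k ^ (s + 1) * m + c = k * (k ^ s * m + c / k) + c % k := by
      intro m c
      conv_lhs => rw [← Nat.div_add_mod c k]
      ring
    have hdiv : ∀ {c}, c < k ^ (s + 1) → c / k < k ^ s := fun hc =>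
      Nat.div_lt_of_lt_mul (by rwa [← pow_succ'])
    rw [hs n, hs i, hs n', hs i', h _ _ _ _ (Nat.mod_lt _ hk) (Nat.mod_lt _ hk),
      h _ _ _ _ (Nat.mod_lt _ hk) (Nat.mod_lt _ hk), ih (hdiv hc) (hdiv hd)]

theorem prod_mulVec_eq_ncard
    (h : ∀ n i c d, c < k → d < k → φ (k * n + c) (k * i + d) = δ (φ n i) c d)
    (w : List (Fin k)) : ∀ n i : ℕ,
      ((w.map (transitionMatrix k δ)).prod.mulVec (acceptVector out)) (φ n i) =
        {j | j < k ^ w.length ∧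
          out (φ (k ^ w.length * n + wordVal k w) (k ^ w.length * i + j))}.ncard := by
  classical
  induction w with
  | nil =>
    intro n i
    have : {j | j < 1 ∧ out (φ n (i + j))} = if out (φ n i) then {0} else ∅ := by
      ext j
      split_ifs with ho <;> simp +contextual [ho]
    simp only [List.map_nil, List.prod_nil, Matrix.one_mulVec, acceptVector, wordVal,
      List.reverse_nil, Nat.ofDigits_nil, List.length_nil, pow_zero, one_mul, add_zero, this]
    split_ifs <;> simp
  | cons c w ih =>
    intro n i
    rw [List.map_cons, List.prod_cons, ← Matrix.mulVec_mulVec]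
    set F := (w.map (transitionMatrix k δ)).prod.mulVec (acceptVector out) with hF
    have e1 : (transitionMatrix k δ c).mulVec F (φ n i) =
        ∑ d ∈ Finset.range k, F (δ (φ n i) c d) := by
      simp only [Matrix.mulVec, dotProduct, transitionMatrix, Finset.sum_mul]
      rw [Finset.sum_comm]
      simp
    rw [e1, List.length_cons, pow_succ', Set.ncard_lt_mul]
    refine Finset.sum_congr rfl fun d hd => ?_
    rw [← h _ _ _ _ c.2 (Finset.mem_range.1 hd), ih]
    have a1 : k ^ w.length * (k * n + c) + wordVal k w =
        k * k ^ w.length * n + wordVal k (c :: w) := by rw [wordVal_cons]; ring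
    have a2 : ∀ j, k ^ w.length * (k * i + d) + j =
        k * k ^ w.length * i + (k ^ w.length * d + j) := fun j => by ring
    simp only [a1, a2]

theorem ncard_eq_dotProduct (hk : 1 < k)
    (h : ∀ n i c d, c < k → d < k → φ (k * n + c) (k * i + d) = δ (φ n i) c d)
    (w : List (Fin k)) (hfin : {i | out (φ (wordVal k w) i)}.Finite) :
    {i | out (φ (wordVal k w) i)}.ncard = (fun q => {m | φ 0 m = q}.ncard) ⬝ᵥ
      ((w.map (transitionMatrix k δ)).prod.mulVec (acceptVector out)) := by
  classical
  set K := k ^ w.length with hK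
  have hK0 : 0 < K := by positivity
  have hsum : {i | out (φ (wordVal k w) i)}.ncard =
      ∑ q : Fin r, {i | φ 0 (i / K) = q ∧ out (φ (wordVal k w) i)}.ncard := by
    rw [Set.ncard_eq_toFinset_card _ hfin,
      Finset.card_eq_sum_card_fiberwise (f := fun i => φ 0 (i / K)) (t := Finset.univ)
        (fun _ _ => Finset.mem_coe.2 (Finset.mem_univ _))]
    refine Finset.sum_congr rfl fun q _ => ?_
    rw [← Set.ncard_coe_finset]
    congr 1
    ext i
    simp [and_comm]
  rw [hsum]
  refine Finset.sum_congr rfl fun q _ => ?_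
  rcases Set.eq_empty_or_nonempty {m | φ 0 m = q} with he | ⟨m₀, hm₀⟩
  · have : {i | φ 0 (i / K) = q ∧ out (φ (wordVal k w) i)} = ∅ := by
      rw [Set.eq_empty_iff_forall_notMem] at he ⊢
      exact fun i hi => he (i / K) hi.1
    simp [this, he]
  · have hm₀ : φ 0 m₀ = q := hm₀
    have hstate : ∀ m j, φ 0 m = q → j < K →
        φ (wordVal k w) (K * m + j) = φ (wordVal k w) (K * m₀ + j) := by
      intro m j hm hj
      have := state_eq_of_append (by omega) h (hm.trans hm₀.symm) w.length (wordVal_lt hk w) hj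
      simpa using this
    conv_rhs => rw [← hm₀, prod_mulVec_eq_ncard out h w 0 m₀, hm₀, ← hK]
    rw [← Set.ncard_prod, mul_zero, zero_add]
    refine Set.ncard_congr (fun i _ => (i / K, i % K)) ?_ ?_ ?_
    · rintro i ⟨hi, ho⟩
      refine ⟨hi, Nat.mod_lt _ hK0, ?_⟩
      rw [← hstate _ _ hi (Nat.mod_lt _ hK0), Nat.div_add_mod]
      exact ho
    · intro i j _ _ hij
      simp only [Prod.mk.injEq] at hij
      rw [← Nat.div_add_mod i K, ← Nat.div_add_mod j K, hij.1, hij.2]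
    · rintro ⟨m, j⟩ ⟨hm, hj, ho⟩
      have hd : (K * m + j) / K = m := by
        rw [Nat.mul_add_div hK0, Nat.div_eq_of_lt hj, add_zero]
      refine ⟨K * m + j, ⟨?_, ?_⟩, ?_⟩
      · rw [hd]; exact hm
      · rw [hstate m j hm hj]; exact ho
      · simp only [hd, Nat.mul_add_mod, Nat.mod_eq_of_lt hj]

end Counting

theorem IsAutomaticRel.isRegularSeq_ncard {k : ℕ} (hk : 1 < k) {P : ℕ → ℕ → Prop}
    (hP : IsAutomaticRel k (fun v => P (v 0) (v 1))) (hfin : ∀ n, {i | P n i}.Finite) :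
    IsRegularSeq ℕ k (fun n => {i | P n i}.ncard) := by
  obtain ⟨Q, hQ, φ, δ, out, h1, h2⟩ := hP
  obtain ⟨r, ⟨e⟩⟩ := Finite.exists_equiv_fin Q
  let pair : ℕ → ℕ → ℕ → ℕ := fun a b i => if i = 0 then a else if i = 1 then b else 0
  let Φ : ℕ → ℕ → Fin r := fun n i => e (φ (pair n i))
  let Δ : Fin r → ℕ → ℕ → Fin r := fun q c d => e (δ (e.symm q) (pair c d))
  have hΦ : ∀ n i c d, c < k → d < k → Φ (k * n + c) (k * i + d) = Δ (Φ n i) c d := by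
    intro n i c d hc hd
    simp only [Φ, Δ, Equiv.symm_apply_apply]
    rw [← h1]
    · congr 2
      funext j
      simp only [pair]
      split_ifs <;> simp
    · intro j
      simp only [pair]
      split_ifs <;> omega
  have hout : ∀ n i, P n i ↔ (out ∘ e.symm) (Φ n i) := by
    intro n i
    simpa [pair, Φ] using h2 (pair n i)
  simp only [hout] at hfin ⊢
  exact ⟨r, _, _, _, fun w => ncard_eq_dotProduct _ hk hΦ w (hfin _)⟩

theorem IsAutomatic.isRegularSeq_permComplexity {k : ℕ} (hk : 2 ≤ k) {A : Type*} [LinearOrder A]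
    {x : ℕ → A} (hx : IsAutomatic k x) : IsRegularSeq ℕ k (permComplexity x) := by
  have h := (hx.first_occurrence hk).isRegularSeq_ncard hk
    (P := fun n i => ∀ j < i, inducedOrder x n i ≠ inducedOrder x n j) (fun n => by
      refine Set.Finite.of_injOn (f := inducedOrder x n) (fun i _ => Set.mem_range_self i) ?_
        (Set.toFinite (Set.range (inducedOrder x n)))
      intro i hi j hj hij
      rcases lt_trichotomy i j with h | h | h
      · exact absurd hij.symm (hj i h)
      · exact h
      · exact absurd hij (hi j h))
  have e : permComplexity x =
      fun n => {i | ∀ j < i, inducedOrder x n i ≠ inducedOrder x n j}.ncard :=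
    funext fun n => Set.ncard_range_eq_ncard_first _
  rwa [e]

theorem thueMorse_two_mul_add (m c : ℕ) (hc : c < 2) :
    thueMorse (2 * m + c) = (thueMorse m + c) % 2 := by
  by_cases h0 : c = 0 ∧ m = 0
  · simp [h0.1, h0.2, thueMorse]
  · rw [thueMorse, add_comm, Nat.digits_add 2 one_lt_two c m hc (by tauto), List.sum_cons, thueMorse]
    omega

theorem isAutomatic_thueMorse : IsAutomatic 2 thueMorse := by
  refine ⟨Fin 2, inferInstance, ⟨fun q c => q + c, 0, ∅⟩, Fin.val, fun w hw => ?_⟩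
  clear hw
  induction w using List.reverseRecOn with
  | nil => simp [wordVal, thueMorse]
  | append_singleton w c ih =>
    rw [wordVal_concat, thueMorse_two_mul_add _ _ c.2, DFA.eval_append_singleton, Fin.val_add, ih]

theorem mainTheorem11 :
    (∀ (k : ℕ) (_ : 2 ≤ k) (A : Type*) [LinearOrder A] (x : ℕ → A),
      IsAutomatic k x → IsRegularSeq ℕ k (permComplexity x)) ∧
    IsRegularSeq ℕ 2 (permComplexity thueMorse) :=
  ⟨fun _ hk _ _ _ hx => hx.isRegularSeq_permComplexity hk,
    isAutomatic_thueMorse.isRegularSeq_permComplexity le_rfl⟩
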